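/- Let $G$ be a graph on $n$ vertices. The Rydberg Hamiltonian of $G$, in the scaled time $s=t/T\in[0,1]$ ($T>0$ the runtime), acts on $(\mathbb C^2)^{\otimes n}$ by $$H(s)=\tfrac12\Omega(s)T\sum_j\sigma^x_j-\Delta(s)T\sum_j n_j+\omega_0T\sum_{\langle i,j\rangle\in E(G)}n_in_j,\qquad n_j=\tfrac12(\sigma^z_j+1).$$ Let $\omega_0T=2\pi L$ with an integer $L\ge1$ and let $\tau=2\pi/(\omega_0T)=1/L$. Call $(\Omega,\Delta)$ an admissible schedule with parameters $(\Omega_{\max},\Delta_{\max},K)$ if on $[0,1]$ we have $|\Omega|\le\Omega_{\max}$, $|\Delta|\le\Delta_{\max}$, $\Omega$ is Lipschitz with constant $K$, and $\Delta$ is constant on each interval $(j\tau,(j+1)\tau)$, $0\le j<L$. Let $\psi$ solve $i\,d\psi/ds=H(s)\psi$ on $[0,1]$, where $\psi(0)$ is a unit vector in the span of the basis states given by independent sets (for example the vacuum). Let $P_{\rm IS}$ be the probability that a measurement of $\psi(1)$ in the computational basis yields an independent set of $G$. Put $a_1=\Omega_{\max}T/2$ and $a_3=(\Omega_{\max}\Delta_{\max}T^2+2\pi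 KT)/(4\pi)$. 1. Fix $T>0$ and $\Omega_{\max},\Delta_{\max},K\ge0$ with $K$ and $\Delta_{\max}$ not both $0$. As $n\to\infty$, $$\sqrt{1-P_{\rm IS}}\le a_1a_3n^2\tau+\Bigl(a_1^2a_3+\frac{\pi}{8}\Omega_{\max}^3T^3\Bigr)n^3\tau^2+O(n^4\tau^3);$$ that is, there are $C\ge0$ and $n_0$, depending only on $T,\Omega_{\max},\Delta_{\max},K$, such that for all $n\ge n_0$, all $G$, $\omega_0$ and $L$ as above, all admissible schedules and all $\psi$ as above, the inequality holds with $Cn^4\tau^3$ as its last term. 2. (Fixed runtime.) If $T,\Omega_{\max},\Delta_{\max},K$ are fixed and $\omega_0\ge cn^2$ with a fixed $c>0$ (in particular if $\omega_0=\Theta(n^2)$), then $\sqrt{1-P_{\rm IS}}\to0$ as $n\to\infty$, uniformly in the graph, in $\omega_0$ (with $\omega_0T\in2\pi\mathbb N$), in the schedule and in $\psi$. 3. (Fixed blockade strength.) If $\omega_0>0$ is fixed, the runtime satisfies $T\le cn^2$ with a fixed $c>0$, and the schedule is admissible with parameters $(\Omega_{\max}/n^2,\Delta_{\max}/n^2,K/n^2)$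 for fixed $\Omega_{\max},\Delta_{\max},K$, then $\sqrt{1-P_{\rm IS}}\to0$ as $n\to\infty$, uniformly in the graph, in $T$ (with $\omega_0T\in2\pi\mathbb N$), in the schedule and in $\psi$. So the algorithm outputs an independent set in time $O(n^2)$ with probability tending to $1$. -/

import Mathlib

namespace Rydberg

noncomputable section

/-- The Hilbert space of `n` two-level atoms. The computational basis is indexed by the sets of
excited vertices, i.e. by the `2 ^ n` classical configurations. -/
abbrev QState (n : ℕ) : Type := EuclideanSpace ℂ (Finset (Fin n))

/-- The Pauli matrix `σˣ_j`: it maps the basis state `S'` to the basis state `S' ∆ {j}`. -/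
def pauliX {n : ℕ} (j : Fin n) : Matrix (Finset (Fin n)) (Finset (Fin n)) ℂ :=
  Matrix.of fun S S' => if S = symmDiff S' {j} then 1 else 0

/-- The Pauli matrix `σᶻ_j`: `+1` on the excited (Rydberg) state of atom `j`, `-1` on its ground
state. -/
def pauliZ {n : ℕ} (j : Fin n) : Matrix (Finset (Fin n)) (Finset (Fin n)) ℂ :=
  Matrix.diagonal fun S => if j ∈ S then 1 else -1

/-- The projection `n_j = (σᶻ_j + 1) / 2` onto the excited state of atom `j`. -/
def numberOp {n : ℕ} (j : Fin n) : Matrix (Finset (Fin n)) (Finset (Fin n)) ℂ :=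
  (1 / 2 : ℂ) • (pauliZ j + 1)

open Classical in
/-- The blockade term `∑_{⟨i,j⟩} n_i n_j`, every edge of `G` being counted once. -/
def blockade {n : ℕ} (G : SimpleGraph (Fin n)) : Matrix (Finset (Fin n)) (Finset (Fin n)) ℂ :=
  ∑ i : Fin n, ∑ j : Fin n, if i < j ∧ G.Adj i j then numberOp i * numberOp j else 0

/-- The Rydberg Hamiltonian with respect to the scaled time `s = t / T`, multiplied by the total
runtime `T`, where `Ω` and `Δ` are the momentary values of the Rabi frequency and the detuning. -/
def hamiltonian {n : ℕ} (G : SimpleGraph (Fin n)) (ω₀ T Ω Δ : ℝ) :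
    Matrix (Finset (Fin n)) (Finset (Fin n)) ℂ :=
  ((Ω * T / 2 : ℝ) : ℂ) • (∑ j : Fin n, pauliX j)
    + (-(((Δ * T : ℝ) : ℂ) • ∑ j : Fin n, numberOp j) + ((ω₀ * T : ℝ) : ℂ) • blockade G)

/-- `ψ` solves the Schrödinger equation `i dψ/ds = H(s) ψ` on `[0, 1]`: it is continuous there and
satisfies the equation outside a finite set of times (the detuning may jump at finitely many
times). -/
def IsEvolution {n : ℕ} (G : SimpleGraph (Fin n)) (ω₀ T : ℝ) (Ω Δ : ℝ → ℝ) (ψ : ℝ → QState n) :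
    Prop :=
  ContinuousOn ψ (Set.Icc 0 1) ∧
    ∃ F : Set ℝ, F.Finite ∧ ∀ s ∈ Set.Ioo (0 : ℝ) 1, s ∉ F →
      HasDerivAt ψ
        (-Complex.I • Matrix.toEuclideanCLM (𝕜 := ℂ) (hamiltonian G ω₀ T (Ω s) (Δ s)) (ψ s)) s

/-- A normalized state of the independent-set subspace. -/
def IsIndepState {n : ℕ} (G : SimpleGraph (Fin n)) (φ : QState n) : Prop :=
  ‖φ‖ = 1 ∧ ∀ S : Finset (Fin n), ¬ G.IsIndepSet (S : Set (Fin n)) → φ S = 0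

open Classical in
/-- The probability that a measurement of `φ` in the computational basis yields an independent
set of `G`. -/
def probIS {n : ℕ} (G : SimpleGraph (Fin n)) (φ : QState n) : ℝ :=
  ∑ S : Finset (Fin n), if G.IsIndepSet (S : Set (Fin n)) then ‖φ S‖ ^ 2 else 0

/-- The assumptions on the control functions on `[0, 1]`: `|Ω| ≤ Ωmax`, `|Δ| ≤ Δmax`, `Ω` is
Lipschitz with constant `K`, and `Δ` is constant on each interval `(j / L, (j + 1) / L)`. -/
structure IsSchedule (L : ℕ) (Ωmax Δmax K : ℝ) (Ω Δ : ℝ → ℝ) : Prop where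
  rabi_bound : ∀ s ∈ Set.Icc (0 : ℝ) 1, |Ω s| ≤ Ωmax
  detuning_bound : ∀ s ∈ Set.Icc (0 : ℝ) 1, |Δ s| ≤ Δmax
  lipschitz : ∀ s ∈ Set.Icc (0 : ℝ) 1, ∀ t ∈ Set.Icc (0 : ℝ) 1, |Ω s - Ω t| ≤ K * |s - t|
  piecewise_const : ∀ j < L, ∃ d : ℝ, ∀ s ∈ Set.Ioo ((j : ℝ) / L) (((j : ℝ) + 1) / L), Δ s = d

/-- The length `τ = 2π / (ω₀ T)` of one blockade oscillation in scaled time. -/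
def tau (ω₀ T : ℝ) : ℝ := 2 * Real.pi / (ω₀ * T)

/-- `a₁ = Ωmax T / 2`. -/
def a₁ (Ωmax T : ℝ) : ℝ := Ωmax * T / 2

/-- `a₃ = (Ωmax Δmax T² + 2π K T) / (4π)`. -/
def a₃ (Ωmax Δmax K T : ℝ) : ℝ :=
  (Ωmax * Δmax * T ^ 2 + 2 * Real.pi * K * T) / (4 * Real.pi)

end

end Rydberg

/-! The Hamiltonian has the form g X - δ N + ω B, where ω = ω₀ T, X is the sum of the n spin flips
and B counts the edges inside a configuration. Independent sets are exactly the level B = 0, so the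
leakage is the norm of Q ψ(1), with Q the projection onto B > 0.

A second-order Schrieffer–Wolff transformation W = 1 + g A + g² A' satisfies W H = H' W + E, with H'
Hermitian and level-preserving (`dressing_mul_fullHam`). Hence Q commutes with H', the H'-part of
the velocity of Q W ψ is orthogonal to Q W ψ, and its norm grows only through E and through the
variation of g. Adding the size of W - 1 at both ends of [0, 1] gives `IsDrive.leakage_le`.

Dividing by integer level differences costs nothing, so A = O(n/ω) and A' = O(n²/ω²). The second
order removes the coupling g² n²/ω, and the commutator of A with N is only O(n/ω) because a flip
changes the excitation number by one. The leakage is therefore O(nτ + n³τ² + n⁴τ³). If a₁a₃n²τ ≥ 1,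
the claim is trivial; otherwise n²τ is bounded, the leakage is O(nτ), and a₁a₃n²τ exceeds it for
large n. The same estimate (`total_le`) gives O(1/n) in both asymptotic regimes. -/

namespace Rydberg

/-! ### Row and column sums as a substitute for the operator norm -/

section SumBound

variable {ι : Type*} [Fintype ι]

/-- All row sums and all column sums of the absolute values of the entries of `M` are at
most `c`. -/
structure SumBound (M : Matrix ι ι ℂ) (c : ℝ) : Prop where
  row : ∀ i, ∑ j, ‖M i j‖ ≤ c
  col : ∀ j, ∑ i, ‖M i j‖ ≤ c

namespace SumBound

variable {M N : Matrix ι ι ℂ} {c d : ℝ}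

theorem mono (h : SumBound M c) (hcd : c ≤ d) : SumBound M d :=
  ⟨fun i => (h.row i).trans hcd, fun j => (h.col j).trans hcd⟩

/-- Monotonicity in the moduli of the entries, which the operator norm lacks, is the reason for
working with `SumBound`: cutting a matrix into blocks or dividing entries by level differences
cannot increase the bound. -/
theorem of_norm_le (h : SumBound N c) {r : ℝ} (hr : 0 ≤ r)
    (hMN : ∀ i j, ‖M i j‖ ≤ r * ‖N i j‖) : SumBound M (r * c) := by
  constructor
  · intro i
    calc ∑ j, ‖M i j‖ ≤ ∑ j, r * ‖N i j‖ := Finset.sum_le_sum fun j _ => hMN i j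
      _ = r * ∑ j, ‖N i j‖ := by rw [Finset.mul_sum]
      _ ≤ r * c := mul_le_mul_of_nonneg_left (h.row i) hr
  · intro j
    calc ∑ i, ‖M i j‖ ≤ ∑ i, r * ‖N i j‖ := Finset.sum_le_sum fun i _ => hMN i j
      _ = r * ∑ i, ‖N i j‖ := by rw [Finset.mul_sum]
      _ ≤ r * c := mul_le_mul_of_nonneg_left (h.col j) hr

theorem of_norm_le_one (h : SumBound N c) (hMN : ∀ i j, ‖M i j‖ ≤ ‖N i j‖) : SumBound M c := by
  simpa using h.of_norm_le zero_le_one (M := M) (by simpa using hMN)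

theorem smul (h : SumBound M c) (a : ℂ) : SumBound (a • M) (‖a‖ * c) :=
  h.of_norm_le (norm_nonneg a) fun i j => by simp

theorem neg (h : SumBound M c) : SumBound (-M) c := h.of_norm_le_one fun i j => by simp

theorem add (hM : SumBound M c) (hN : SumBound N d) : SumBound (M + N) (c + d) := by
  constructor
  · intro i
    calc ∑ j, ‖(M + N) i j‖ ≤ ∑ j, (‖M i j‖ + ‖N i j‖) :=
          Finset.sum_le_sum fun j _ => norm_add_le _ _
      _ ≤ c + d := by rw [Finset.sum_add_distrib]; exact add_le_add (hM.row i) (hN.row i)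
  · intro j
    calc ∑ i, ‖(M + N) i j‖ ≤ ∑ i, (‖M i j‖ + ‖N i j‖) :=
          Finset.sum_le_sum fun i _ => norm_add_le _ _
      _ ≤ c + d := by rw [Finset.sum_add_distrib]; exact add_le_add (hM.col j) (hN.col j)

theorem sub (hM : SumBound M c) (hN : SumBound N d) : SumBound (M - N) (c + d) := by
  rw [sub_eq_add_neg]
  exact hM.add hN.neg

theorem zero : SumBound (0 : Matrix ι ι ℂ) 0 := ⟨fun i => by simp, fun j => by simp⟩

theorem sum {κ : Type*} (s : Finset κ) {f : κ → Matrix ι ι ℂ} {e : κ → ℝ}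
    (h : ∀ k ∈ s, SumBound (f k) (e k)) : SumBound (∑ k ∈ s, f k) (∑ k ∈ s, e k) := by
  classical
  induction s using Finset.induction_on with
  | empty => simpa using zero
  | insert a s ha ih =>
    rw [Finset.sum_insert ha, Finset.sum_insert ha]
    exact (h a (Finset.mem_insert_self a s)).add
      (ih fun k hk => h k (Finset.mem_insert_of_mem hk))

theorem diagonal [DecidableEq ι] {v : ι → ℂ} (h : ∀ i, ‖v i‖ ≤ c) :
    SumBound (Matrix.diagonal v) c := by
  constructor
  · intro i
    rw [Finset.sum_eq_single i (fun j _ hj => by simp [Matrix.diagonal_apply_ne' v hj])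
      (by simp)]
    simpa using h i
  · intro j
    rw [Finset.sum_eq_single j (fun i _ hi => by simp [Matrix.diagonal_apply_ne v hi])
      (by simp)]
    simpa using h j

theorem mul (hM : SumBound M c) (hN : SumBound N d) : SumBound (M * N) (c * d) := by
  have key : ∀ i j, ‖(M * N) i j‖ ≤ ∑ k, ‖M i k‖ * ‖N k j‖ := fun i j => by
    rw [Matrix.mul_apply]
    exact (norm_sum_le _ _).trans_eq (Finset.sum_congr rfl fun k _ => norm_mul _ _)
  constructor
  · intro i
    have hd : 0 ≤ d := (Finset.sum_nonneg fun j _ => norm_nonneg _).trans (hN.row i)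
    calc ∑ j, ‖(M * N) i j‖ ≤ ∑ j, ∑ k, ‖M i k‖ * ‖N k j‖ := Finset.sum_le_sum fun j _ => key i j
      _ = ∑ k, ‖M i k‖ * ∑ j, ‖N k j‖ := by rw [Finset.sum_comm]; simp_rw [Finset.mul_sum]
      _ ≤ ∑ k, ‖M i k‖ * d :=
          Finset.sum_le_sum fun k _ => mul_le_mul_of_nonneg_left (hN.row k) (norm_nonneg _)
      _ = (∑ k, ‖M i k‖) * d := by rw [Finset.sum_mul]
      _ ≤ c * d := mul_le_mul_of_nonneg_right (hM.row i) hd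
  · intro j
    have hc : 0 ≤ c := (Finset.sum_nonneg fun j _ => norm_nonneg _).trans (hM.row j)
    calc ∑ i, ‖(M * N) i j‖ ≤ ∑ i, ∑ k, ‖M i k‖ * ‖N k j‖ := Finset.sum_le_sum fun i _ => key i j
      _ = ∑ k, (∑ i, ‖M i k‖) * ‖N k j‖ := by rw [Finset.sum_comm]; simp_rw [Finset.sum_mul]
      _ ≤ ∑ k, c * ‖N k j‖ :=
          Finset.sum_le_sum fun k _ => mul_le_mul_of_nonneg_right (hM.col k) (norm_nonneg _)
      _ = c * ∑ k, ‖N k j‖ := by rw [Finset.mul_sum]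
      _ ≤ c * d := mul_le_mul_of_nonneg_left (hN.col j) hc

/-- The Schur test. -/
theorem norm_toEuclideanCLM_le [DecidableEq ι] (h : SumBound M c) (hc : 0 ≤ c)
    (v : EuclideanSpace ℂ ι) : ‖Matrix.toEuclideanCLM (𝕜 := ℂ) M v‖ ≤ c * ‖v‖ := by
  refine le_of_sq_le_sq ?_ (by positivity)
  rw [mul_pow, EuclideanSpace.norm_sq_eq, EuclideanSpace.norm_sq_eq]
  have key : ∀ i, ‖(Matrix.toEuclideanCLM (𝕜 := ℂ) M v) i‖ ^ 2
      ≤ c * ∑ j, ‖M i j‖ * ‖v j‖ ^ 2 := fun i => by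
    have h1 : ‖(Matrix.toEuclideanCLM (𝕜 := ℂ) M v) i‖ ≤ ∑ j, ‖M i j‖ * ‖v j‖ := by
      rw [Matrix.ofLp_toEuclideanCLM, Matrix.mulVec, dotProduct]
      exact (norm_sum_le _ _).trans_eq (Finset.sum_congr rfl fun k _ => norm_mul _ _)
    calc _ ≤ (∑ j, ‖M i j‖ * ‖v j‖) ^ 2 := by gcongr
      -- Cauchy–Schwarz with the weights `‖M i j‖`.
      _ ≤ (∑ j, ‖M i j‖) * ∑ j, ‖M i j‖ * ‖v j‖ ^ 2 :=
          Finset.sum_sq_le_sum_mul_sum_of_sq_le_mul _ (fun j _ => norm_nonneg _)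
            (fun j _ => by positivity) (fun j _ => by apply le_of_eq; ring)
      _ ≤ _ := by
          gcongr
          exact h.row i
  calc _ ≤ ∑ i, c * ∑ j, ‖M i j‖ * ‖v j‖ ^ 2 := Finset.sum_le_sum fun i _ => key i
    _ = c * ∑ j, (∑ i, ‖M i j‖) * ‖v j‖ ^ 2 := by
        rw [← Finset.mul_sum, Finset.sum_comm]
        simp_rw [Finset.sum_mul]
    _ ≤ c * ∑ j, c * ‖v j‖ ^ 2 := by
        gcongr with j
        exact h.col j
    _ = c ^ 2 * ∑ j, ‖v j‖ ^ 2 := by rw [← Finset.mul_sum]; ring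

end SumBound

end SumBound

/-! ### The dressing transformation as an algebraic identity -/

section Dressing

variable {ι : Type*} [Fintype ι] [DecidableEq ι]

/-- The part of `M` that preserves the level `b`. -/
def blockPart {ι : Type*} (b : ι → ℕ) (M : Matrix ι ι ℂ) : Matrix ι ι ℂ :=
  Matrix.of fun i j => if b i = b j then M i j else 0

/-- The part of `M` that changes the level `b`, every entry being divided by the change (the
division by zero inside a level gives the entry zero). -/
noncomputable def offPart {ι : Type*} (b : ι → ℕ) (M : Matrix ι ι ℂ) : Matrix ι ι ℂ :=
  Matrix.of fun i j => M i j / ((b i : ℂ) - b j)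

/-- The level operator. -/
def level (b : ι → ℕ) : Matrix ι ι ℂ := Matrix.diagonal fun i => (b i : ℂ)

/-- The projection onto the positive levels. -/
def excitedProj (b : ι → ℕ) : Matrix ι ι ℂ := Matrix.diagonal fun i => if b i = 0 then 0 else 1

/-- The commutator with `level b` multiplies the (i, j) entry by `b i - b j`, so `offPart` inverts
it between different levels. Inside a level the convention x / 0 = 0 matches the vanishing of `M -
blockPart b M`. -/
theorem level_mul_offPart (b : ι → ℕ) (M : Matrix ι ι ℂ) :
    level b * offPart b M = offPart b M * level b + (M - blockPart b M) := by
  ext i j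
  simp only [level, offPart, blockPart, Matrix.diagonal_mul, Matrix.mul_diagonal, Matrix.add_apply,
    Matrix.sub_apply, Matrix.of_apply]
  by_cases h : b i = b j
  · simp [h]
  · have h' : (b i : ℂ) - b j ≠ 0 := sub_ne_zero.2 (by exact_mod_cast h)
    rw [if_neg h]
    field_simp
    ring

/-- Different levels are different integers, hence at distance at least 1; this is the spectral gap
of the blockade term. -/
theorem norm_offPart_le {ι : Type*} (b : ι → ℕ) (M : Matrix ι ι ℂ) (i j : ι) :
    ‖offPart b M i j‖ ≤ ‖M i j‖ := by
  simp only [offPart, Matrix.of_apply, norm_div]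
  by_cases h : b i = b j
  · simp [h]
  · refine div_le_self (norm_nonneg _) ?_
    have h1 : (1 : ℤ) ≤ |(b i : ℤ) - b j| :=
      Int.one_le_abs (sub_ne_zero.2 (by exact_mod_cast h))
    have h2 := Complex.norm_intCast ((b i : ℤ) - b j)
    push_cast at h2
    rw [h2]
    exact_mod_cast h1

end Dressing
end Rydberg

namespace Rydberg
section Dressing

theorem norm_blockPart_le {ι : Type*} (b : ι → ℕ) (M : Matrix ι ι ℂ) (i j : ι) :
    ‖blockPart b M i j‖ ≤ ‖M i j‖ := by
  simp only [blockPart, Matrix.of_apply]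
  split_ifs <;> simp

theorem SumBound.blockPart {ι : Type*} [Fintype ι] {b : ι → ℕ} {M : Matrix ι ι ℂ} {c : ℝ} (h : SumBound M c) :
    SumBound (Rydberg.blockPart b M) c := h.of_norm_le_one (norm_blockPart_le b M)

theorem SumBound.offPart {ι : Type*} [Fintype ι] {b : ι → ℕ} {M : Matrix ι ι ℂ} {c : ℝ} (h : SumBound M c) :
    SumBound (Rydberg.offPart b M) c := h.of_norm_le_one (norm_offPart_le b M)

theorem isHermitian_blockPart {ι : Type*} {b : ι → ℕ} {M : Matrix ι ι ℂ} (h : M.IsHermitian) :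
    (blockPart b M).IsHermitian := by
  ext i j
  have := h.apply i j
  simp only [blockPart, Matrix.conjTranspose_apply, Matrix.of_apply]
  by_cases hb : b i = b j
  · simpa [hb] using this
  · simp [hb, Ne.symm hb]

variable {ι : Type*} [Fintype ι] [DecidableEq ι]

theorem excitedProj_mul_blockPart (b : ι → ℕ) (M : Matrix ι ι ℂ) :
    excitedProj b * blockPart b M = blockPart b M * excitedProj b := by
  ext i j
  simp only [excitedProj, blockPart, Matrix.diagonal_mul, Matrix.mul_diagonal, Matrix.of_apply]
  by_cases hb : b i = b j <;> simp [hb]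

variable (b : ι → ℕ) (X N : Matrix ι ι ℂ) (ω g δ : ℝ)

/-- The first-order generator of the dressing transformation. -/
noncomputable def dressOne : Matrix ι ι ℂ := (ω⁻¹ : ℂ) • offPart b X

/-- The second-order coupling of the dressed frame. -/
noncomputable def secondCoupling : Matrix ι ι ℂ := dressOne b X ω * X - blockPart b X * dressOne b X ω

/-- The second-order coefficient of the dressing transformation. -/
noncomputable def dressTwo : Matrix ι ι ℂ := (ω⁻¹ : ℂ) • offPart b (secondCoupling b X ω)

/-- The dressing transformation. -/
noncomputable def dressing : Matrix ι ι ℂ :=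
  1 + ((g : ℂ) • dressOne b X ω + (g ^ 2 : ℂ) • dressTwo b X ω)

/-- The Hamiltonian with drive `g`, detuning `δ` and blockade strength `ω`. -/
noncomputable def fullHam : Matrix ι ι ℂ :=
  (g : ℂ) • X + (-((δ : ℂ) • N) + (ω : ℂ) • level b)

/-- The level-preserving effective Hamiltonian of the dressed frame. -/
noncomputable def effHam : Matrix ι ι ℂ :=
  (g : ℂ) • blockPart b X + (-((δ : ℂ) • N) + (ω : ℂ) • level b)
    + (g ^ 2 : ℂ) • blockPart b (secondCoupling b X ω)

/-- The remainder of the dressing transformation. -/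
noncomputable def dressErr : Matrix ι ι ℂ :=
  -((g * δ : ℂ) • (dressOne b X ω * N - N * dressOne b X ω))
    - (g ^ 2 * δ : ℂ) • (dressTwo b X ω * N - N * dressTwo b X ω)
    + (g ^ 3 : ℂ) • (dressTwo b X ω * X - blockPart b X * dressTwo b X ω
        - blockPart b (secondCoupling b X ω) * dressOne b X ω)
    - (g ^ 4 : ℂ) • (blockPart b (secondCoupling b X ω) * dressTwo b X ω)

variable {ω}

theorem level_mul_smul_offPart (hω : ω ≠ 0) (M : Matrix ι ι ℂ) :
    ((ω : ℂ) • level b) * ((ω⁻¹ : ℂ) • offPart b M)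
      = ((ω⁻¹ : ℂ) • offPart b M) * ((ω : ℂ) • level b) + (M - blockPart b M) := by
  have h : (ω : ℂ) ≠ 0 := by exact_mod_cast hω
  simp only [smul_mul_smul_comm, mul_inv_cancel₀ h, inv_mul_cancel₀ h, one_smul,
    level_mul_offPart]

/-- Commuting A and A' past ω B produces the level-changing parts of X and of the second coupling,
with the sign that cancels them at orders g and g². What remains are commutators with the detuning
term and terms of order g³ and g⁴. -/
theorem dressing_mul_fullHam (hω : ω ≠ 0) :
    dressing b X ω g * fullHam b X N ω g δ
      = effHam b X N ω g δ * dressing b X ω g + dressErr b X N ω g δ := by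
  have h1 : ((ω : ℂ) • level b) * dressOne b X ω = _ := level_mul_smul_offPart b hω X
  have h2 : ((ω : ℂ) • level b) * dressTwo b X ω = _ :=
    level_mul_smul_offPart b hω (secondCoupling b X ω)
  change _ = dressOne b X ω * _ + _ at h1
  change _ = dressTwo b X ω * _ + _ at h2
  have h3 : secondCoupling b X ω = dressOne b X ω * X - blockPart b X * dressOne b X ω := rfl
  unfold dressing fullHam effHam dressErr
  -- Only the two commutation relations and the formula for the second coupling matter from here on;
  -- the rest is noncommutative algebra.
  generalize dressOne b X ω = A at *
  generalize dressTwo b X ω = A' at *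
  generalize secondCoupling b X ω = Z at *
  generalize (ω : ℂ) • level b = D at *
  generalize blockPart b X = X₀ at *
  generalize blockPart b Z = Y at *
  simp only [add_mul, mul_add, neg_mul, mul_neg, one_mul, mul_one,
    smul_mul_assoc, mul_smul_comm, h1, h2, smul_add, smul_sub, smul_neg, h3]
  module

variable {b X N}

omit [DecidableEq ι] in
-- Inside a level the subtracted product vanishes, since A has no entries there. The remaining entry
-- ω⁻¹ ∑ₖ Xᵢₖ Xₖⱼ / (bᵢ - bₖ) is conjugate-symmetric because bᵢ = bⱼ.
theorem isHermitian_blockPart_secondCoupling (hX : X.IsHermitian) :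
    (blockPart b (secondCoupling b X ω)).IsHermitian := by
  have key : ∀ i j, b i = b j → secondCoupling b X ω i j
      = ∑ k, (ω⁻¹ : ℂ) * (X i k / ((b i : ℂ) - b k) * X k j) := fun i j h => by
    have h0 : (blockPart b X * dressOne b X ω) i j = 0 := by
      rw [Matrix.mul_apply]
      refine Finset.sum_eq_zero fun k _ => ?_
      by_cases hk : b i = b k
      · simp [dressOne, offPart, ← hk, ← h]
      · simp [blockPart, hk]
    rw [secondCoupling, Matrix.sub_apply, h0, sub_zero, Matrix.mul_apply]
    refine Finset.sum_congr rfl fun k _ => ?_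
    simp [dressOne, offPart, mul_assoc]
  ext i j
  simp only [blockPart, Matrix.conjTranspose_apply, Matrix.of_apply]
  by_cases hb : b i = b j
  · rw [if_pos hb, if_pos hb.symm, key i j hb, key j i hb.symm, star_sum]
    refine Finset.sum_congr rfl fun k _ => ?_
    have h1 := hX.apply i k
    have h2 := hX.apply k j
    simp only [RCLike.star_def] at h1 h2
    simp only [RCLike.star_def, map_mul, map_div₀, map_inv₀, map_sub, Complex.conj_ofReal,
      Complex.conj_natCast, h1, h2, hb]
    ring
  · simp [hb, Ne.symm hb]

theorem isHermitian_real_smul {ι : Type*} (a : ℝ) {M : Matrix ι ι ℂ} (hM : M.IsHermitian) :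
    ((a : ℂ) • M).IsHermitian := by
  rw [Matrix.IsHermitian, Matrix.conjTranspose_smul, hM.eq]
  simp

theorem isHermitian_level {ι : Type*} [DecidableEq ι] (b : ι → ℕ) : (level b).IsHermitian := by
  rw [level, Matrix.isHermitian_diagonal_iff]
  intro i
  simp [IsSelfAdjoint]

theorem isHermitian_effHam (hX : X.IsHermitian) (hN : N.IsHermitian) :
    (effHam b X N ω g δ).IsHermitian := by
  have := isHermitian_real_smul (g ^ 2)
    (isHermitian_blockPart_secondCoupling (b := b) (ω := ω) hX)
  push_cast at this
  exact ((isHermitian_real_smul g (isHermitian_blockPart hX)).add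
    ((isHermitian_real_smul δ hN).neg.add (isHermitian_real_smul ω (isHermitian_level b)))).add this

theorem excitedProj_mul_effHam (hN : excitedProj b * N = N * excitedProj b) :
    excitedProj b * effHam b X N ω g δ = effHam b X N ω g δ * excitedProj b := by
  have hl : excitedProj b * level b = level b * excitedProj b := by
    simp [excitedProj, level, mul_comm]
  simp only [effHam, mul_add, add_mul, mul_neg, neg_mul, mul_smul_comm, smul_mul_assoc,
    excitedProj_mul_blockPart, hN, hl]

end Dressing
end Rydberg

namespace Rydberg
open Filter Topology

/-! ### Growth estimates from one-sided slopes -/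

section Calculus

/-- A mean value inequality with one-sided slopes, suited to a norm, which may fail to be
differentiable at zeros, and to a dressing that is merely Lipschitz in time. Induction on `F` cuts
the interval at each exceptional point. -/
theorem sub_le_of_slope_le {f : ℝ → ℝ} {c : ℝ} {F : Set ℝ} (hF : F.Finite) :
    ∀ {a b : ℝ}, a ≤ b → ContinuousOn f (Set.Icc a b) →
      (∀ s ∈ Set.Ioo a b, s ∉ F → ∀ r, c < r → ∀ᶠ z in 𝓝[>] s, slope f s z < r) →
      f b - f a ≤ c * (b - a) := by
  induction F, hF using Set.Finite.induction_on with
  | empty =>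
    intro a b hab hf h
    rcases hab.eq_or_lt with rfl | hab
    · simp
    -- Nothing is assumed about slopes at `a` itself, so the estimate starts at `a' > a` and
    -- continuity lets `a'` tend to `a`.
    have key : ∀ a' ∈ Set.Ioo a b, f b - f a' ≤ c * (b - a') := fun a' ha' => by
      have := image_le_of_liminf_slope_right_le_deriv_boundary (f := f) (a := a') (b := b)
        (hf.mono (Set.Icc_subset_Icc_left ha'.1.le)) (B := fun x => f a' + c * (x - a'))
        (B' := fun _ => c) (by simp) (by fun_prop)
        (fun x _ => by
          simpa using
            ((((hasDerivAt_id x).sub_const a').const_mul c).const_add (f a')).hasDerivWithinAt)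
        (fun x hx r hr => (h x ⟨ha'.1.trans_le hx.1, hx.2⟩ (by simp) r hr).frequently)
        (Set.right_mem_Icc.2 ha'.2.le)
      linarith
    have hcont : ContinuousWithinAt (fun a' => f b - f a') (Set.Ioi a) a :=
      continuousWithinAt_const.sub
        (((hf a (Set.left_mem_Icc.2 hab.le)).mono Set.Ioc_subset_Icc_self).mono_of_mem_nhdsWithin
          (Ioc_mem_nhdsGT hab))
    have hlin : ContinuousWithinAt (fun a' => c * (b - a')) (Set.Ioi a) a := by fun_prop
    exact le_of_tendsto_of_tendsto hcont hlin
      (Filter.mem_of_superset (Ioo_mem_nhdsGT hab) key)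
  | @insert x F _ _ ih =>
    intro a b hab hf h
    by_cases hx : x ∈ Set.Ioo a b
    · have h1 := ih hx.1.le (hf.mono (Set.Icc_subset_Icc_right hx.2.le)) fun s hs hsF =>
        h s ⟨hs.1, hs.2.trans hx.2⟩ (by simp [hsF, hs.2.ne])
      have h2 := ih hx.2.le (hf.mono (Set.Icc_subset_Icc_left hx.1.le)) fun s hs hsF =>
        h s ⟨hx.1.trans hs.1, hs.2⟩ (by simp [hsF, hs.1.ne'])
      linarith
    · exact ih hab hf fun s hs hsF => h s hs (by
        rintro (rfl | h')
        exacts [hx hs, hsF h'])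

theorem eventually_slope_lt_of_hasDerivAt {f : ℝ → ℝ} {f' s r : ℝ} (h : HasDerivAt f f' s)
    (hr : f' < r) : ∀ᶠ z in 𝓝[>] s, slope f s z < r :=
  ((h.tendsto_slope.mono_left
    (nhdsWithin_mono s fun _ hx => ne_of_gt hx)).eventually (gt_mem_nhds hr))

theorem eq_of_hasDerivAt_zero {f : ℝ → ℝ} {F : Set ℝ} (hF : F.Finite) {a b : ℝ} (hab : a ≤ b)
    (hf : ContinuousOn f (Set.Icc a b))
    (h : ∀ s ∈ Set.Ioo a b, s ∉ F → HasDerivAt f 0 s) : f b = f a := by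
  have h1 := sub_le_of_slope_le (c := 0) hF hab hf fun s hs hsF r hr =>
    eventually_slope_lt_of_hasDerivAt (h s hs hsF) hr
  have h2 := sub_le_of_slope_le (c := 0) hF hab hf.neg fun s hs hsF r hr =>
    eventually_slope_lt_of_hasDerivAt (f' := 0) (by simpa using (h s hs hsF).neg) hr
  simp only [Pi.neg_apply] at h2
  linarith

/-- A component `u` of the velocity that is orthogonal to the position does not contribute to the
growth of the norm. -/
theorem eventually_slope_norm_lt {E : Type*} [NormedAddCommGroup E] [InnerProductSpace ℝ E]
    {v : ℝ → E} {u w : E} {s r : ℝ} (h : HasDerivAt v (u + w) s) (hu : inner ℝ (v s) u = 0)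
    (hu0 : v s = 0 → u = 0) (hr : ‖w‖ < r) :
    ∀ᶠ z in 𝓝[>] s, slope (fun x => ‖v x‖) s z < r := by
  -- At a zero of `v` the norm need not be differentiable, but there `u` vanishes and the slope is
  -- controlled by `‖w‖` alone. Elsewhere the norm is differentiated as the square root of its
  -- square.
  by_cases hv : v s = 0
  · rw [hu0 hv, zero_add] at h
    have := (h.hasDerivWithinAt (s := Set.Ioi s)).limsup_slope_norm_le hr
    filter_upwards [this, self_mem_nhdsWithin] with z hz hzs
    have hzs' : 0 < z - s := sub_pos.2 hzs
    rw [slope_def_field, div_eq_inv_mul]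
    rwa [Real.norm_of_nonneg hzs'.le] at hz
  · have hv' : 0 < ‖v s‖ := norm_pos_iff.2 hv
    have h1 := h.norm_sq.sqrt (by positivity)
    simp only [Real.sqrt_sq (norm_nonneg _)] at h1
    refine eventually_slope_lt_of_hasDerivAt h1 (lt_of_le_of_lt ?_ hr)
    rw [inner_add_right, hu, zero_add, div_le_iff₀ (by positivity)]
    nlinarith [real_inner_le_norm (v s) w]

end Calculus

/-! ### Conservation of the norm -/

section Unitary

variable {ι : Type*} [Fintype ι] [DecidableEq ι]

/-- The expectation of a Hermitian matrix is real, and the real inner product is the real part of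
the complex one. -/
theorem inner_neg_I_smul_eq_zero {H : Matrix ι ι ℂ} (hH : H.IsHermitian)
    (v : EuclideanSpace ℂ ι) :
    inner ℝ v (-Complex.I • Matrix.toEuclideanCLM (𝕜 := ℂ) H v) = 0 := by
  have hre : ∀ x y : EuclideanSpace ℂ ι, inner ℝ x y = (inner ℂ x y : ℂ).re := fun x y => by
    simp [PiLp.inner_apply, Complex.inner]
  have hsym := (ContinuousLinearMap.isSelfAdjoint_iff_isSymmetric.1
    (show IsSelfAdjoint (Matrix.toEuclideanCLM (𝕜 := ℂ) H) from by
      rw [IsSelfAdjoint, ← map_star, Matrix.star_eq_conjTranspose, hH.eq])) v v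
  have him : (inner ℂ v (Matrix.toEuclideanCLM (𝕜 := ℂ) H v) : ℂ).im = 0 := by
    rw [← Complex.conj_eq_iff_im, inner_conj_symm]
    exact hsym
  rw [hre, inner_smul_right]
  simp [him]

theorem norm_eq_of_evolution {H : ℝ → Matrix ι ι ℂ} (hH : ∀ s, (H s).IsHermitian)
    {ψ : ℝ → EuclideanSpace ℂ ι} (hψ : ContinuousOn ψ (Set.Icc 0 1)) {F : Set ℝ} (hF : F.Finite)
    (hd : ∀ s ∈ Set.Ioo (0 : ℝ) 1, s ∉ F →
      HasDerivAt ψ (-Complex.I • Matrix.toEuclideanCLM (𝕜 := ℂ) (H s) (ψ s)) s)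
    {s : ℝ} (hs : s ∈ Set.Icc (0 : ℝ) 1) : ‖ψ s‖ = ‖ψ 0‖ := by
  have : ‖ψ s‖ ^ 2 = ‖ψ 0‖ ^ 2 := eq_of_hasDerivAt_zero (f := fun x => ‖ψ x‖ ^ 2) hF hs.1
    ((hψ.mono (Set.Icc_subset_Icc_right hs.2)).norm.pow 2) fun x hx hxF => by
      have := (hd x ⟨hx.1, hx.2.trans_le hs.2⟩ hxF).norm_sq
      rwa [inner_neg_I_smul_eq_zero (hH x), mul_zero] at this
  exact (pow_left_inj₀ (norm_nonneg _) (norm_nonneg _) two_ne_zero).1 this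

end Unitary
end Rydberg

namespace Rydberg
open Filter Topology

/-! ### The leakage estimate for a general drive -/

section Leakage

variable {ι : Type*} [Fintype ι] [DecidableEq ι]

theorem SumBound.excitedProj (b : ι → ℕ) : SumBound (Rydberg.excitedProj b) 1 :=
  SumBound.diagonal fun i => by split_ifs <;> simp

/-- A Hermitian drive `X` of strength `m`, which changes the excitation number `ν ≤ m` at most
by one in every transition. -/
structure IsDrive (X : Matrix ι ι ℂ) (ν : ι → ℝ) (m : ℝ) : Prop where
  hermitian : X.IsHermitian
  sumBound : SumBound X m
  number_bound : ∀ i, |ν i| ≤ m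
  number_step : ∀ i j, X i j ≠ 0 → |ν i - ν j| ≤ 1

/-- The number operator of an excitation number `ν`. -/
noncomputable def numberMatrix (ν : ι → ℝ) : Matrix ι ι ℂ := Matrix.diagonal fun i => (ν i : ℂ)

variable {b : ι → ℕ} {X : Matrix ι ι ℂ} {ν : ι → ℝ} {m ω : ℝ}

omit [Fintype ι] in
theorem isHermitian_numberMatrix : (numberMatrix ν).IsHermitian := by
  rw [numberMatrix, Matrix.isHermitian_diagonal_iff]
  intro i
  simp [IsSelfAdjoint]

omit [Fintype ι] in
theorem isHermitian_fullHam (hX : X.IsHermitian) {g δ : ℝ} :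
    (fullHam b X (numberMatrix ν) ω g δ).IsHermitian := by
  exact (isHermitian_real_smul g hX).add ((isHermitian_real_smul δ isHermitian_numberMatrix).neg.add
    (isHermitian_real_smul ω (isHermitian_level b)))

omit [DecidableEq ι] in
theorem SumBound.dressOne (hX : SumBound X m) (hω : 0 < ω) :
    SumBound (Rydberg.dressOne b X ω) (m / ω) :=
  (hX.offPart.smul (ω⁻¹ : ℂ)).mono (by
    rw [norm_inv, Complex.norm_real, Real.norm_of_nonneg hω.le]
    exact (inv_mul_eq_div _ _).le)

omit [DecidableEq ι] in
theorem SumBound.secondCoupling (hX : SumBound X m) (hω : 0 < ω) :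
    SumBound (Rydberg.secondCoupling b X ω) (2 * m ^ 2 / ω) :=
  (((hX.dressOne hω).mul hX).sub (hX.blockPart.mul (hX.dressOne hω))).mono
    (by apply le_of_eq; ring)

omit [DecidableEq ι] in
theorem SumBound.dressTwo (hX : SumBound X m) (hω : 0 < ω) :
    SumBound (Rydberg.dressTwo b X ω) (2 * m ^ 2 / ω ^ 2) :=
  ((hX.secondCoupling hω).offPart.smul (ω⁻¹ : ℂ)).mono (by
    rw [norm_inv, Complex.norm_real, Real.norm_of_nonneg hω.le]
    apply le_of_eq
    field_simp)

/-- Each entry of A is multiplied by a difference of excitation numbers, of modulus at most 1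
wherever X is nonzero. The crude bound 2m²/ω would put the detuning error at order n²τ, that of the
claimed main term. -/
theorem IsDrive.sumBound_commutator_dressOne (hX : IsDrive X ν m) (hω : 0 < ω) :
    SumBound (Rydberg.dressOne b X ω * numberMatrix ν - numberMatrix ν * Rydberg.dressOne b X ω)
      (m / ω) := by
  refine (hX.sumBound.dressOne hω (b := b)).of_norm_le_one fun i j => ?_
  simp only [numberMatrix, Matrix.sub_apply, Matrix.mul_diagonal, Matrix.diagonal_mul]
  by_cases h : X i j = 0
  · simp [dressOne, offPart, h]
  · have h1 := hX.number_step i j h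
    rw [mul_comm (ν i : ℂ), ← mul_sub, norm_mul, ← Complex.ofReal_sub, Complex.norm_real,
      Real.norm_eq_abs, abs_sub_comm]
    exact mul_le_of_le_one_right (norm_nonneg _) h1

theorem IsDrive.sumBound_commutator_dressTwo (hX : IsDrive X ν m) (hω : 0 < ω) :
    SumBound (Rydberg.dressTwo b X ω * numberMatrix ν - numberMatrix ν * Rydberg.dressTwo b X ω)
      (4 * m ^ 3 / ω ^ 2) := by
  have hN : SumBound (numberMatrix ν) m := SumBound.diagonal fun i => by
    simpa using hX.number_bound i
  have h2 := hX.sumBound.dressTwo hω (b := b)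
  exact ((h2.mul hN).sub (hN.mul h2)).mono (by apply le_of_eq; ring)

/-- The rate at which the dressed state leaks. -/
noncomputable def errRate (m ω γ d : ℝ) : ℝ :=
  γ * d * (m / ω) + γ ^ 2 * d * (4 * m ^ 3 / ω ^ 2) + γ ^ 3 * (6 * m ^ 3 / ω ^ 2)
    + γ ^ 4 * (4 * m ^ 4 / ω ^ 3)

theorem IsDrive.sumBound_dressErr (hX : IsDrive X ν m) (hm : 0 ≤ m) (hω : 0 < ω) {g δ γ d : ℝ}
    (hg : |g| ≤ γ) (hδ : |δ| ≤ d) :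
    SumBound (dressErr b X (numberMatrix ν) ω g δ) (errRate m ω γ d) := by
  have h1 := hX.sumBound.dressOne hω (b := b)
  have h2 := hX.sumBound.dressTwo hω (b := b)
  have hY := (hX.sumBound.secondCoupling hω (b := b)).blockPart (b := b)
  have hX0 := hX.sumBound.blockPart (b := b)
  have hd : 0 ≤ d := (abs_nonneg _).trans hδ
  have hγ : 0 ≤ γ := (abs_nonneg _).trans hg
  refine (((((hX.sumBound_commutator_dressOne hω).smul (g * δ : ℂ)).neg.sub
    ((hX.sumBound_commutator_dressTwo hω).smul (g ^ 2 * δ : ℂ))).add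
    ((((h2.mul hX.sumBound).sub (hX0.mul h2)).sub (hY.mul h1)).smul (g ^ 3 : ℂ))).sub
    ((hY.mul h2).smul (g ^ 4 : ℂ))).mono ?_
  simp only [norm_mul, norm_pow, Complex.norm_real, Real.norm_eq_abs]
  have e1 : 2 * m ^ 2 / ω ^ 2 * m + m * (2 * m ^ 2 / ω ^ 2) + 2 * m ^ 2 / ω * (m / ω)
      = 6 * m ^ 3 / ω ^ 2 := by field_simp; ring
  have e2 : 2 * m ^ 2 / ω * (2 * m ^ 2 / ω ^ 2) = 4 * m ^ 4 / ω ^ 3 := by field_simp; ring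
  rw [e1, e2, errRate]
  gcongr

/-- The norm of the dressing correction. -/
noncomputable def dressSize (m ω γ : ℝ) : ℝ := γ * (m / ω) + γ ^ 2 * (2 * m ^ 2 / ω ^ 2)

theorem IsDrive.sumBound_dressing_sub_one (hX : IsDrive X ν m) (hm : 0 ≤ m) (hω : 0 < ω)
    {g γ : ℝ} (hg : |g| ≤ γ) : SumBound (dressing b X ω g - 1) (dressSize m ω γ) := by
  rw [dressing, add_sub_cancel_left]
  refine (((hX.sumBound.dressOne hω).smul (g : ℂ)).add
    ((hX.sumBound.dressTwo hω).smul (g ^ 2 : ℂ))).mono ?_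
  simp only [norm_pow, Complex.norm_real, Real.norm_eq_abs]
  rw [dressSize]
  gcongr

/-- The rate at which the dressing transformation changes. -/
noncomputable def dressRate (m ω γ k : ℝ) : ℝ :=
  k * (m / ω) + 2 * γ * k * (2 * m ^ 2 / ω ^ 2)

/-- A Lipschitz estimate replaces the time derivative of the dressing, since g need not be
differentiable. -/
theorem IsDrive.sumBound_dressing_sub (hX : IsDrive X ν m) (hm : 0 ≤ m) (hω : 0 < ω)
    {g g' γ k t : ℝ} (hg : |g| ≤ γ) (hg' : |g'| ≤ γ) (hk : |g - g'| ≤ k * t) :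
    SumBound (dressing b X ω g - dressing b X ω g') (dressRate m ω γ k * t) := by
  have e : dressing b X ω g - dressing b X ω g' = ((g - g' : ℝ) : ℂ) • dressOne b X ω
      + (((g + g') * (g - g') : ℝ) : ℂ) • dressTwo b X ω := by
    simp only [dressing]
    push_cast
    module
  rw [e]
  refine (((hX.sumBound.dressOne hω).smul _).add ((hX.sumBound.dressTwo hω).smul _)).mono ?_
  simp only [Complex.norm_real, Real.norm_eq_abs, abs_mul]
  have h2 : |g + g'| ≤ 2 * γ := (abs_add_le _ _).trans (by linarith)
  have hγ : 0 ≤ γ := (abs_nonneg _).trans hg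
  calc |g - g'| * (m / ω) + |g + g'| * |g - g'| * (2 * m ^ 2 / ω ^ 2)
      ≤ k * t * (m / ω) + 2 * γ * (k * t) * (2 * m ^ 2 / ω ^ 2) := by gcongr
    _ = _ := by rw [dressRate]; ring

/-- The quantity followed in time is `f`, the norm of Q W ψ. Its slope is at most `errRate +
dressRate`, and passing between Q ψ and Q W ψ costs one `dressSize` at each end. -/
theorem IsDrive.leakage_le (hX : IsDrive X ν m) (hm : 0 ≤ m) (hω : 0 < ω) {γ d k : ℝ}
    {g δ : ℝ → ℝ} (hg : ∀ s ∈ Set.Icc (0 : ℝ) 1, |g s| ≤ γ)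
    (hδ : ∀ s ∈ Set.Icc (0 : ℝ) 1, |δ s| ≤ d)
    (hk : ∀ s ∈ Set.Icc (0 : ℝ) 1, ∀ t ∈ Set.Icc (0 : ℝ) 1, |g s - g t| ≤ k * |s - t|)
    {ψ : ℝ → EuclideanSpace ℂ ι} (hψ : ContinuousOn ψ (Set.Icc 0 1)) {F : Set ℝ} (hF : F.Finite)
    (hd : ∀ s ∈ Set.Ioo (0 : ℝ) 1, s ∉ F → HasDerivAt ψ
      (-Complex.I • Matrix.toEuclideanCLM (𝕜 := ℂ)
        (fullHam b X (numberMatrix ν) ω (g s) (δ s)) (ψ s)) s)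
    (h0 : ‖ψ 0‖ = 1) (hQ : Matrix.toEuclideanCLM (𝕜 := ℂ) (excitedProj b) (ψ 0) = 0) :
    ‖Matrix.toEuclideanCLM (𝕜 := ℂ) (excitedProj b) (ψ 1)‖
      ≤ 2 * dressSize m ω γ + errRate m ω γ d + dressRate m ω γ k := by
  have mem0 : (0 : ℝ) ∈ Set.Icc (0 : ℝ) 1 := by simp
  have mem1 : (1 : ℝ) ∈ Set.Icc (0 : ℝ) 1 := by simp
  have hγ : 0 ≤ γ := (abs_nonneg _).trans (hg 0 mem0)
  have hd0 : 0 ≤ d := (abs_nonneg _).trans (hδ 0 mem0)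
  have hk0 : 0 ≤ k := by simpa using (abs_nonneg _).trans (hk 0 mem0 1 mem1)
  have herr0 : 0 ≤ errRate m ω γ d := by unfold errRate; positivity
  have hrate0 : 0 ≤ dressRate m ω γ k := by unfold dressRate; positivity
  have hsize0 : 0 ≤ dressSize m ω γ := by unfold dressSize; positivity
  have hnorm : ∀ s ∈ Set.Icc (0 : ℝ) 1, ‖ψ s‖ = 1 := fun s hs =>
    (norm_eq_of_evolution (fun s => isHermitian_fullHam hX.hermitian) hψ hF hd hs).trans h0
  set Op : Matrix ι ι ℂ → EuclideanSpace ℂ ι →L[ℂ] EuclideanSpace ℂ ι :=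
    fun M => Matrix.toEuclideanCLM (𝕜 := ℂ) M with hOp
  set Q := excitedProj b
  have op_mul : ∀ M M' x, Op (M * M') x = Op M (Op M' x) := fun M M' x => by simp [hOp]
  have op_sub : ∀ M M' x, Op (M - M') x = Op M x - Op M' x := fun M M' x => by simp [hOp]
  have op_add : ∀ M M' x, Op (M + M') x = Op M x + Op M' x := fun M M' x => by simp [hOp]
  have op_smul : ∀ (a : ℂ) M x, Op (a • M) x = a • Op M x := fun a M x => by
    simp only [hOp, map_smul]
    rfl
  have op_one : ∀ x, Op 1 x = x := fun x => by simp [hOp]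
  have hproj : ∀ x, ‖Op Q x‖ ≤ ‖x‖ := fun x => by
    simpa using (SumBound.excitedProj b).norm_toEuclideanCLM_le zero_le_one x
  have hsize : ∀ s ∈ Set.Icc (0 : ℝ) 1,
      ‖Op Q (Op (dressing b X ω (g s)) (ψ s)) - Op Q (ψ s)‖ ≤ dressSize m ω γ := fun s hs => by
    rw [← map_sub]
    refine (hproj _).trans ?_
    have := (hX.sumBound_dressing_sub_one hm hω (hg s hs) (b := b)).norm_toEuclideanCLM_le
      hsize0 (ψ s)
    rw [hnorm s hs, mul_one] at this
    rwa [← op_one (ψ s), ← op_mul, mul_one, ← op_sub]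
  have hdiff : ∀ s ∈ Set.Icc (0 : ℝ) 1, ∀ t ∈ Set.Icc (0 : ℝ) 1,
      ‖Op Q (Op (dressing b X ω (g t)) (ψ t)) - Op Q (Op (dressing b X ω (g s)) (ψ t))‖
        ≤ dressRate m ω γ k * |t - s| := fun s hs t ht => by
    rw [← map_sub, ← op_sub]
    refine (hproj _).trans ?_
    have := (hX.sumBound_dressing_sub hm hω (hg t ht) (hg s hs)
      (hk t ht s hs) (b := b)).norm_toEuclideanCLM_le (by positivity) (ψ t)
    rwa [hnorm t ht, mul_one] at this
  set f : ℝ → ℝ := fun z => ‖Op Q (Op (dressing b X ω (g z)) (ψ z))‖ with hf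
  have hfc : ContinuousOn f (Set.Icc 0 1) := by
    have hgc : ContinuousOn (fun s => (g s : ℂ)) (Set.Icc 0 1) := by
      refine Complex.continuous_ofReal.comp_continuousOn ?_
      exact (LipschitzOnWith.of_dist_le_mul (K := k.toNNReal) fun s hs t ht => by
        simpa [Real.dist_eq, hk0] using hk s hs t ht).continuousOn
    have e : ∀ z, Op (dressing b X ω (g z)) (ψ z)
        = ψ z + ((g z : ℂ) • Op (dressOne b X ω) (ψ z)
          + (g z : ℂ) ^ 2 • Op (dressTwo b X ω) (ψ z)) := fun z => by
      rw [dressing, op_add, op_add, op_smul, op_smul, op_one]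
    simp only [hf, e]
    refine ((Op Q).continuous.comp_continuousOn ?_).norm
    exact hψ.add ((hgc.smul ((Op _).continuous.comp_continuousOn hψ)).add
      ((hgc.pow 2).smul ((Op _).continuous.comp_continuousOn hψ)))
  have hslope : ∀ s ∈ Set.Ioo (0 : ℝ) 1, s ∉ F → ∀ r, errRate m ω γ d + dressRate m ω γ k < r →
      ∀ᶠ z in 𝓝[>] s, slope f s z < r := fun s hs hsF r hr => by
    have hs' : s ∈ Set.Icc (0 : ℝ) 1 := Set.Ioo_subset_Icc_self hs
    -- The dressing is frozen at time `s`, so that only ψ is differentiated; its own variation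
    -- enters afterwards through `hdiff`.
    set W := dressing b X ω (g s)
    set E := dressErr b X (numberMatrix ν) ω (g s) (δ s)
    have hcomm : Q * effHam b X (numberMatrix ν) ω (g s) (δ s)
        = effHam b X (numberMatrix ν) ω (g s) (δ s) * Q :=
      excitedProj_mul_effHam _ _ (by simp [excitedProj, numberMatrix, mul_comm])
    have hv : HasDerivAt (fun z => Op Q (Op W (ψ z)))
        (-Complex.I • Op (effHam b X (numberMatrix ν) ω (g s) (δ s)) (Op Q (Op W (ψ s)))
          + -Complex.I • Op Q (Op E (ψ s))) s := by
      have h1 := ((Op Q).restrictScalars ℝ).hasFDerivAt.comp_hasDerivAt s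
        (((Op W).restrictScalars ℝ).hasFDerivAt.comp_hasDerivAt s (hd s hs hsF))
      refine h1.congr_deriv ?_
      rw [← smul_add]
      change Op Q (Op W (-Complex.I • Op _ (ψ s))) = _
      rw [map_smul, map_smul]
      congr 1
      rw [← op_mul W, dressing_mul_fullHam b X _ _ _ hω.ne', ← op_mul _ Q,
        ← hcomm, op_add, op_mul (effHam _ _ _ _ _ _) W, map_add, op_mul]
    have hE : ‖-Complex.I • Op Q (Op E (ψ s))‖ ≤ errRate m ω γ d := by
      rw [norm_smul, norm_neg, Complex.norm_I, one_mul]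
      refine (hproj _).trans ?_
      have := (hX.sumBound_dressErr hm hω (hg s hs') (hδ s hs') (b := b)).norm_toEuclideanCLM_le
        herr0 (ψ s)
      rwa [hnorm s hs', mul_one] at this
    have h2 := eventually_slope_norm_lt hv
      (inner_neg_I_smul_eq_zero (isHermitian_effHam _ _ hX.hermitian isHermitian_numberMatrix) _)
      (fun h => by rw [h]; simp) (r := r - dressRate m ω γ k) (by linarith)
    filter_upwards [h2, Ioo_mem_nhdsGT hs.2] with z hz hzs
    have hzs' : 0 < z - s := sub_pos.2 hzs.1
    have h3 := hdiff s hs' z ⟨hs.1.le.trans hzs.1.le, hzs.2.le⟩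
    rw [abs_of_pos hzs'] at h3
    have h4 := (norm_le_norm_add_norm_sub' (Op Q (Op (dressing b X ω (g z)) (ψ z)))
      (Op Q (Op W (ψ z)))).trans (add_le_add_right h3 _)
    rw [slope_def_field, div_lt_iff₀ hzs'] at hz ⊢
    simp only [hf]
    linarith
  have hfin := sub_le_of_slope_le hF zero_le_one hfc hslope
  have hf0 : f 0 ≤ dressSize m ω γ := by
    have := hsize 0 mem0
    rwa [show Op Q (ψ 0) = 0 from hQ, sub_zero] at this
  have hf1 : ‖Op Q (ψ 1)‖ ≤ f 1 + dressSize m ω γ := by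
    have h5 := norm_le_norm_add_norm_sub (Op Q (Op (dressing b X ω (g 1)) (ψ 1))) (Op Q (ψ 1))
    exact h5.trans (add_le_add_right (hsize 1 mem1) _)
  change ‖Op Q (ψ 1)‖ ≤ _
  linarith

end Leakage
end Rydberg

namespace Rydberg

/-! ### The Rydberg Hamiltonian as an instance -/

section Atoms

variable {n : ℕ}

open Classical in
/-- The number of edges of `G` inside a configuration. -/
noncomputable def edgeCount (G : SimpleGraph (Fin n)) (S : Finset (Fin n)) : ℕ :=
  ∑ i : Fin n, ∑ j : Fin n, if (i < j ∧ G.Adj i j) ∧ i ∈ S ∧ j ∈ S then 1 else 0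

theorem edgeCount_eq_zero_iff (G : SimpleGraph (Fin n)) (S : Finset (Fin n)) :
    edgeCount G S = 0 ↔ G.IsIndepSet (S : Set (Fin n)) := by
  simp only [edgeCount, Finset.sum_eq_zero_iff, Finset.mem_univ, forall_const, ite_eq_right_iff,
    one_ne_zero, imp_false]
  refine ⟨fun h i hi j hj hij hadj => ?_, fun h i j hij => ?_⟩
  · rcases lt_or_gt_of_ne hij with hlt | hlt
    · exact h i j ⟨⟨hlt, hadj⟩, hi, hj⟩
    · exact h j i ⟨⟨hlt, hadj.symm⟩, hj, hi⟩
  · exact h hij.2.1 hij.2.2 hij.1.1.ne hij.1.2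

theorem numberOp_eq_diagonal (j : Fin n) :
    numberOp j = Matrix.diagonal fun S => if j ∈ S then (1 : ℂ) else 0 := by
  ext S S'
  by_cases h : S = S'
  · subst h
    by_cases hj : j ∈ S
    · simp [numberOp, pauliZ, hj]
      norm_num
    · simp [numberOp, pauliZ, hj]
  · simp [numberOp, pauliZ, h]

theorem blockade_eq_level (G : SimpleGraph (Fin n)) : blockade G = level (edgeCount G) := by
  classical
  ext S S'
  simp only [blockade, numberOp_eq_diagonal, Matrix.diagonal_mul_diagonal, Matrix.sum_apply, level]
  by_cases h : S = S'
  · subst h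
    simp only [Matrix.diagonal_apply_eq, edgeCount, Nat.cast_sum]
    refine Finset.sum_congr rfl fun i _ => Finset.sum_congr rfl fun j _ => ?_
    by_cases hij : i < j ∧ G.Adj i j <;> by_cases hi : i ∈ S <;> by_cases hj : j ∈ S <;>
      simp [hij, hi, hj]
  · rw [Matrix.diagonal_apply_ne _ h]
    refine Finset.sum_eq_zero fun i _ => Finset.sum_eq_zero fun j _ => ?_
    split_ifs <;> simp [h]

theorem sum_numberOp : ∑ j : Fin n, numberOp j = numberMatrix fun S => (S.card : ℝ) := by
  ext S S'
  simp only [numberOp_eq_diagonal, Matrix.sum_apply, numberMatrix]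
  by_cases h : S = S'
  · subst h
    simp
  · simp [h]

theorem hamiltonian_eq_fullHam (G : SimpleGraph (Fin n)) (ω₀ T Ω Δ : ℝ) :
    hamiltonian G ω₀ T Ω Δ = fullHam (edgeCount G) (∑ j : Fin n, pauliX j)
      (numberMatrix fun S => (S.card : ℝ)) (ω₀ * T) (Ω * T / 2) (Δ * T) := by
  rw [hamiltonian, fullHam, blockade_eq_level, sum_numberOp]

theorem eq_symmDiff_comm (S S' : Finset (Fin n)) (j : Fin n) :
    S = symmDiff S' {j} ↔ S' = symmDiff S {j} := by
  constructor <;> rintro rfl <;> simp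

theorem sumBound_pauliX (j : Fin n) : SumBound (pauliX j) 1 := by
  constructor
  · intro S
    simp [pauliX, eq_symmDiff_comm S, apply_ite (norm : ℂ → ℝ)]
  · intro S
    simp [pauliX, apply_ite (norm : ℂ → ℝ)]

theorem isDrive_sum_pauliX :
    IsDrive (∑ j : Fin n, pauliX j) (fun S : Finset (Fin n) => (S.card : ℝ)) n where
  hermitian := by
    ext S S'
    simp only [Matrix.conjTranspose_apply, Matrix.sum_apply, star_sum, pauliX, Matrix.of_apply,
      eq_symmDiff_comm S']
    exact Finset.sum_congr rfl fun j _ => by split_ifs <;> simp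
  sumBound := by simpa using SumBound.sum Finset.univ fun j _ => sumBound_pauliX (n := n) j
  number_bound S := by
    rw [Nat.abs_cast]
    exact_mod_cast (Finset.card_le_univ S).trans_eq (Fintype.card_fin n)
  number_step S S' h := by
    rw [Matrix.sum_apply] at h
    obtain ⟨j, -, hj⟩ := Finset.exists_ne_zero_of_sum_ne_zero h
    have hS : S = symmDiff S' {j} := by
      by_contra hne
      simp [pauliX, hne] at hj
    subst hS
    by_cases hj : j ∈ S'
    · have e : symmDiff S' {j} = S'.erase j := by
        ext x
        by_cases hx : x = j <;> simp [Finset.mem_symmDiff, hx, hj]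
      rw [e, ← Finset.card_erase_add_one hj]
      simp
    · have e : symmDiff S' {j} = insert j S' := by
        ext x
        by_cases hx : x = j <;> simp [Finset.mem_symmDiff, hx, hj]
      rw [e, Finset.card_insert_of_notMem hj]
      simp

theorem excitedProj_apply (G : SimpleGraph (Fin n)) (φ : QState n) (S : Finset (Fin n)) :
    Matrix.toEuclideanCLM (𝕜 := ℂ) (excitedProj (edgeCount G)) φ S
      = if edgeCount G S = 0 then 0 else φ S := by
  rw [Matrix.ofLp_toEuclideanCLM, excitedProj, Matrix.mulVec_diagonal]
  split_ifs <;> simp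

theorem one_sub_probIS (G : SimpleGraph (Fin n)) {φ : QState n} (hφ : ‖φ‖ = 1) :
    1 - probIS G φ = ‖Matrix.toEuclideanCLM (𝕜 := ℂ) (excitedProj (edgeCount G)) φ‖ ^ 2 := by
  have h1 : ∑ S, ‖φ S‖ ^ 2 = 1 := by rw [← EuclideanSpace.norm_sq_eq, hφ, one_pow]
  rw [EuclideanSpace.norm_sq_eq, probIS, ← h1, ← Finset.sum_sub_distrib]
  refine Finset.sum_congr rfl fun S _ => ?_
  rw [excitedProj_apply]
  by_cases h : G.IsIndepSet (S : Set (Fin n))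
  · simp [h, (edgeCount_eq_zero_iff G S).2 h]
  · simp [h, mt (edgeCount_eq_zero_iff G S).1 h]

theorem probIS_nonneg (G : SimpleGraph (Fin n)) (φ : QState n) : 0 ≤ probIS G φ :=
  Finset.sum_nonneg fun S _ => by split_ifs <;> positivity

theorem sqrt_one_sub_probIS_le_one (G : SimpleGraph (Fin n)) (φ : QState n) :
    √(1 - probIS G φ) ≤ 1 :=
  Real.sqrt_le_one.2 (by linarith [probIS_nonneg G φ])

theorem sqrt_one_sub_probIS_le {G : SimpleGraph (Fin n)} {ω₀ T Ωmax Δmax K : ℝ} {L : ℕ}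
    (hT : 0 < T) (hω : 0 < ω₀ * T) {Ω Δ : ℝ → ℝ} (hs : IsSchedule L Ωmax Δmax K Ω Δ)
    {ψ : ℝ → QState n} (hψ : IsEvolution G ω₀ T Ω Δ ψ) (h0 : IsIndepState G (ψ 0)) :
    √(1 - probIS G (ψ 1)) ≤ 2 * dressSize n (ω₀ * T) (Ωmax * T / 2)
      + errRate n (ω₀ * T) (Ωmax * T / 2) (Δmax * T)
      + dressRate n (ω₀ * T) (Ωmax * T / 2) (K * T / 2) := by
  obtain ⟨hc, F, hF, hd⟩ := hψ
  simp only [hamiltonian_eq_fullHam] at hd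
  have hn := norm_eq_of_evolution
    (fun s => isHermitian_fullHam isDrive_sum_pauliX.hermitian) hc hF hd
    (Set.right_mem_Icc.2 zero_le_one)
  rw [one_sub_probIS G (hn.trans h0.1), Real.sqrt_sq (norm_nonneg _)]
  refine isDrive_sum_pauliX.leakage_le n.cast_nonneg hω (g := fun s => Ω s * T / 2)
    (δ := fun s => Δ s * T) (fun s hs' => ?_) (fun s hs' => ?_) (fun s hs' t ht => ?_) hc hF hd
    h0.1 ?_
  · rw [abs_div, abs_mul, abs_of_pos hT, abs_of_pos (zero_lt_two' ℝ)]
    have := hs.rabi_bound s hs'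
    gcongr
  · rw [abs_mul, abs_of_pos hT]
    have := hs.detuning_bound s hs'
    gcongr
  · rw [← sub_div, ← sub_mul, abs_div, abs_mul, abs_of_pos hT, abs_of_pos (zero_lt_two' ℝ)]
    have := hs.lipschitz s hs' t ht
    calc |Ω s - Ω t| * T / 2 ≤ K * |s - t| * T / 2 := by gcongr
      _ = _ := by ring
  · ext S
    rw [excitedProj_apply]
    split_ifs with h
    · rfl
    · exact h0.2 S (mt (edgeCount_eq_zero_iff G S).2 h)

/-- A bound for the leakage constant in terms of bounds for the scaled controls. -/
noncomputable def leakConst (p q g d M : ℝ) : ℝ :=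
  2 * p + 4 * p ^ 2 * M + p * d + 4 * M * p ^ 2 * d + 6 * g * M * p ^ 2 + 4 * g * M ^ 2 * p ^ 3
    + q + 4 * p * q * M

/-- Here `y` is the small parameter. Every term contains a factor `y` once `u` and `w` are bounded
by multiples of it; the surplus factors `y` and `m * y` are absorbed by `M`. -/
theorem total_le {m ω γ d k p q g' d' M y : ℝ} (hm : 0 ≤ m) (hω : 0 < ω) (hγ : 0 ≤ γ) (hd : 0 ≤ d)
    (hk : 0 ≤ k) (hy : 0 ≤ y) (hp : γ * (m / ω) ≤ p * y) (hq : k * (m / ω) ≤ q * y)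
    (hp0 : 0 ≤ p) (hq0 : 0 ≤ q) (hg : γ ≤ g') (hd' : d ≤ d') (hM : y ≤ M) (hmy : m * y ≤ M) :
    2 * dressSize m ω γ + errRate m ω γ d + dressRate m ω γ k ≤ y * leakConst p q g' d' M := by
  have hM0 : 0 ≤ M := hy.trans hM
  have hg0 : 0 ≤ g' := hγ.trans hg
  have hd0 : 0 ≤ d' := hd.trans hd'
  set u := γ * (m / ω) with hu
  set w := k * (m / ω) with hw
  have hu0 : 0 ≤ u := by positivity
  have hw0 : 0 ≤ w := by positivity
  have e : 2 * dressSize m ω γ + errRate m ω γ d + dressRate m ω γ k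
      = 2 * u + 4 * u ^ 2 + u * d + 4 * (m * u ^ 2) * d + 6 * γ * (m * u ^ 2)
        + 4 * γ * (m * u ^ 3) + w + 4 * (u * w) := by
    simp only [dressSize, errRate, dressRate, hu, hw]
    field_simp
    ring
  have h2 : u ^ 2 ≤ p ^ 2 * (y * M) := by
    calc u ^ 2 ≤ (p * y) ^ 2 := by gcongr
      _ = p ^ 2 * (y * y) := by ring
      _ ≤ _ := by gcongr
  have h3 : m * u ^ 2 ≤ p ^ 2 * (y * M) := by
    calc m * u ^ 2 ≤ m * (p * y) ^ 2 := by gcongr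
      _ = p ^ 2 * (y * (m * y)) := by ring
      _ ≤ _ := by gcongr
  have h4 : m * u ^ 3 ≤ p ^ 3 * (y * (M * M)) := by
    calc m * u ^ 3 ≤ m * (p * y) ^ 3 := by gcongr
      _ = p ^ 3 * (y * ((m * y) * y)) := by ring
      _ ≤ _ := by gcongr
  have h5 : u * w ≤ p * q * (y * M) := by
    calc u * w ≤ (p * y) * (q * y) := by gcongr
      _ = p * q * (y * y) := by ring
      _ ≤ _ := by gcongr
  rw [e]
  calc _ ≤ 2 * (p * y) + 4 * (p ^ 2 * (y * M)) + p * y * d' + 4 * (p ^ 2 * (y * M)) * d'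
        + 6 * g' * (p ^ 2 * (y * M)) + 4 * g' * (p ^ 3 * (y * (M * M))) + q * y
        + 4 * (p * q * (y * M)) := by gcongr
    _ = _ := by unfold leakConst; ring

end Atoms
end Rydberg

/-! ### Asymptotics in the number of vertices -/

namespace Rydberg

theorem IsSchedule.of_rabi_zero {L : ℕ} {Δmax K : ℝ} {Ω Δ : ℝ → ℝ}
    (h : IsSchedule L 0 Δmax K Ω Δ) : IsSchedule L 0 Δmax 0 Ω Δ where
  rabi_bound := h.rabi_bound
  detuning_bound := h.detuning_bound
  lipschitz s hs t ht := by
    have h1 := abs_nonpos_iff.1 (h.rabi_bound s hs)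
    have h2 := abs_nonpos_iff.1 (h.rabi_bound t ht)
    simp [h1, h2]
  piecewise_const := h.piecewise_const

theorem leakage_bound (T Ωmax Δmax K : ℝ) (hT : 0 < T) (hΩ : 0 ≤ Ωmax) (hΔ : 0 ≤ Δmax)
    (hK : 0 ≤ K) (hKΔ : 0 < K ∨ 0 < Δmax) :
    ∃ n₀ : ℕ, ∀ n : ℕ, n₀ ≤ n →
      ∀ (G : SimpleGraph (Fin n)) (ω₀ : ℝ) (L : ℕ), 0 < ω₀ * T →
      ∀ Ω Δ : ℝ → ℝ, IsSchedule L Ωmax Δmax K Ω Δ →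
      ∀ ψ : ℝ → QState n, IsEvolution G ω₀ T Ω Δ ψ → IsIndepState G (ψ 0) →
        √(1 - probIS G (ψ 1)) ≤ a₁ Ωmax T * a₃ Ωmax Δmax K T * (n : ℝ) ^ 2 * tau ω₀ T := by
  rcases hΩ.eq_or_lt with rfl | hΩ'
  -- The right-hand side is 0 here. As Ω vanishes on [0, 1], the Lipschitz constant may be taken to
  -- be 0, and then every term of the leakage estimate vanishes.
  · refine ⟨0, fun n _ G ω₀ L hω Ω Δ hs ψ hψ h0 => ?_⟩
    simpa [dressSize, errRate, dressRate, a₁] using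
      sqrt_one_sub_probIS_le hT hω hs.of_rabi_zero hψ h0
  have hD : 0 < a₁ Ωmax T * a₃ Ωmax Δmax K T := by
    have h3 : 0 < Ωmax * Δmax * T ^ 2 + 2 * Real.pi * K * T := by
      rcases hKΔ with h | h
      · have : 0 ≤ Ωmax * Δmax * T ^ 2 := by positivity
        have : 0 < 2 * Real.pi * K * T := by positivity
        linarith
      · have : 0 < Ωmax * Δmax * T ^ 2 := by positivity
        have : 0 ≤ 2 * Real.pi * K * T := by positivity
        linarith
    unfold a₁ a₃
    positivity
  set D := a₁ Ωmax T * a₃ Ωmax Δmax K T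
  -- With y = n / (ω₀ T) one has D n² τ = 2π D n y, so `M` is the bound on n y when D n² τ < 1.
  set M := 1 / (2 * Real.pi * D) with hM
  set c := leakConst (Ωmax * T / 2) (K * T / 2) (Ωmax * T / 2) (Δmax * T) M
  -- This threshold makes c ≤ 2π D n, so the leakage bound y c is at most 2π D n y; n ≥ 1 yields y ≤
  -- n y ≤ M.
  refine ⟨max 1 ⌈c / (2 * Real.pi * D)⌉₊, fun n hn G ω₀ L hω Ω Δ hs ψ hψ h0 => ?_⟩
  have hn1 : (1 : ℝ) ≤ n := by exact_mod_cast (le_max_left _ _).trans hn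
  have hnc : c / (2 * Real.pi * D) ≤ n :=
    (Nat.le_ceil _).trans (by exact_mod_cast (le_max_right _ _).trans hn)
  by_cases hlarge : 1 ≤ D * (n : ℝ) ^ 2 * tau ω₀ T
  · exact (sqrt_one_sub_probIS_le_one G _).trans hlarge
  push Not at hlarge
  set y := (n : ℝ) / (ω₀ * T) with hy
  have hy0 : 0 ≤ y := by positivity
  have htau : D * (n : ℝ) ^ 2 * tau ω₀ T = 2 * Real.pi * D * (n * y) := by
    rw [tau, hy]
    ring
  have hny : n * y ≤ M := by
    rw [hM, le_div_iff₀ (by positivity), mul_comm, ← htau]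
    exact hlarge.le
  refine (sqrt_one_sub_probIS_le hT hω hs hψ h0).trans ((total_le n.cast_nonneg hω (by positivity)
    (by positivity) (by positivity) hy0 le_rfl le_rfl (by positivity) (by positivity) le_rfl le_rfl
    ((le_mul_of_one_le_left hy0 hn1).trans hny) hny).trans ?_)
  rw [div_le_iff₀ (by positivity)] at hnc
  rw [htau]
  calc y * c ≤ y * (n * (2 * Real.pi * D)) := by gcongr
    _ = _ := by ring

theorem exists_forall_div_le (c : ℝ) {ε : ℝ} (hε : 0 < ε) :
    ∃ n₀ : ℕ, ∀ n : ℕ, n₀ ≤ n → (1 : ℝ) ≤ n ∧ 1 / (n : ℝ) * c ≤ ε := by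
  refine ⟨max 1 ⌈c / ε⌉₊, fun n hn => ?_⟩
  have hn1 : (1 : ℝ) ≤ n := by exact_mod_cast (le_max_left _ _).trans hn
  have hnc : c / ε ≤ n :=
    (Nat.le_ceil _).trans (by exact_mod_cast (le_max_right _ _).trans hn)
  refine ⟨hn1, ?_⟩
  rw [div_le_iff₀ hε] at hnc
  rw [one_div_mul_eq_div, div_le_iff₀ (by linarith)]
  linarith

theorem leakage_tendsto_zero_of_fixed_runtime (T Ωmax Δmax K c : ℝ) (hT : 0 < T)
    (hΩ : 0 ≤ Ωmax) (hΔ : 0 ≤ Δmax) (hK : 0 ≤ K) (hc : 0 < c) (ε : ℝ) (hε : 0 < ε) :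
    ∃ n₀ : ℕ, ∀ n : ℕ, n₀ ≤ n →
      ∀ (G : SimpleGraph (Fin n)) (ω₀ : ℝ) (L : ℕ), c * (n : ℝ) ^ 2 ≤ ω₀ →
      ∀ Ω Δ : ℝ → ℝ, IsSchedule L Ωmax Δmax K Ω Δ →
      ∀ ψ : ℝ → QState n, IsEvolution G ω₀ T Ω Δ ψ → IsIndepState G (ψ 0) →
        √(1 - probIS G (ψ 1)) ≤ ε := by
  obtain ⟨n₀, hn₀⟩ := exists_forall_div_le
    (leakConst (Ωmax * T / 2 / (c * T)) (K * T / 2 / (c * T)) (Ωmax * T / 2) (Δmax * T) 1) hε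
  refine ⟨n₀, fun n hn G ω₀ L hω₀ Ω Δ hs ψ hψ h0 => ?_⟩
  obtain ⟨hn1, hle⟩ := hn₀ n hn
  have hn0 : (0 : ℝ) < n := by linarith
  have hω : 0 < ω₀ * T := mul_pos (lt_of_lt_of_le (by positivity) hω₀) hT
  -- This permits y = 1 / n and M = 1 in `total_le`, as n y = 1.
  have hx : (n : ℝ) / (ω₀ * T) ≤ 1 / (c * T) * (1 / n) := by
    calc (n : ℝ) / (ω₀ * T) ≤ n / (c * (n : ℝ) ^ 2 * T) := by gcongr
      _ = _ := by field_simp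
  refine (sqrt_one_sub_probIS_le hT hω hs hψ h0).trans ((total_le n.cast_nonneg hω (by positivity)
    (by positivity) (by positivity) (by positivity) ?_ ?_ (by positivity) (by positivity) le_rfl
    le_rfl ((div_le_one hn0).2 hn1) (mul_one_div_cancel hn0.ne').le).trans hle)
  · rw [div_eq_mul_one_div _ (c * T), mul_assoc]
    gcongr
  · rw [div_eq_mul_one_div _ (c * T), mul_assoc]
    gcongr

theorem leakage_tendsto_zero_of_fixed_blockade (ω₀ Ωmax Δmax K c : ℝ) (hω₀ : 0 < ω₀)
    (hΩ : 0 ≤ Ωmax) (hΔ : 0 ≤ Δmax) (hK : 0 ≤ K) (ε : ℝ) (hε : 0 < ε) :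
    ∃ n₀ : ℕ, ∀ n : ℕ, n₀ ≤ n →
      ∀ (G : SimpleGraph (Fin n)) (T : ℝ) (L : ℕ), 0 < T → T ≤ c * (n : ℝ) ^ 2 →
      ∀ Ω Δ : ℝ → ℝ,
        IsSchedule L (Ωmax / (n : ℝ) ^ 2) (Δmax / (n : ℝ) ^ 2) (K / (n : ℝ) ^ 2) Ω Δ →
      ∀ ψ : ℝ → QState n, IsEvolution G ω₀ T Ω Δ ψ → IsIndepState G (ψ 0) →
        √(1 - probIS G (ψ 1)) ≤ ε := by
  obtain ⟨n₀, hn₀⟩ := exists_forall_div_le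
    (leakConst (Ωmax / (2 * ω₀)) (K / (2 * ω₀)) (Ωmax * c / 2) (Δmax * c) 1) hε
  refine ⟨n₀, fun n hn G T L hT hTn Ω Δ hs ψ hψ h0 => ?_⟩
  obtain ⟨hn1, hle⟩ := hn₀ n hn
  have hn0 : (0 : ℝ) < n := by linarith
  have hω : 0 < ω₀ * T := mul_pos hω₀ hT
  -- The scaled controls stay bounded. In the products with n / (ω₀ T) the runtime cancels and a
  -- factor 1 / n is left, so again y = 1 / n and M = 1.
  have hbound : ∀ A : ℝ, 0 ≤ A → A / (n : ℝ) ^ 2 * T ≤ A * c := fun A hA => by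
    rw [div_mul_eq_mul_div, div_le_iff₀ (by positivity), mul_assoc]
    gcongr
  refine (sqrt_one_sub_probIS_le hT hω hs hψ h0).trans ((total_le n.cast_nonneg hω (by positivity)
    (by positivity) (by positivity) (by positivity) ?_ ?_ (by positivity) (by positivity)
    (div_le_div_of_nonneg_right (hbound Ωmax hΩ) zero_le_two) (hbound Δmax hΔ)
    ((div_le_one hn0).2 hn1) (mul_one_div_cancel hn0.ne').le).trans hle)
  · apply le_of_eq
    field_simp
  · apply le_of_eq
    field_simp

end Rydberg

theorem mainTheorem1 :
    -- the leakage bound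
    (∀ T Ωmax Δmax K : ℝ, 0 < T → 0 ≤ Ωmax → 0 ≤ Δmax → 0 ≤ K → (0 < K ∨ 0 < Δmax) →
      ∃ C : ℝ, 0 ≤ C ∧ ∃ n₀ : ℕ, ∀ n : ℕ, n₀ ≤ n →
        ∀ (G : SimpleGraph (Fin n)) (ω₀ : ℝ) (L : ℕ), 0 < L → ω₀ * T = 2 * Real.pi * L →
        ∀ Ω Δ : ℝ → ℝ, Rydberg.IsSchedule L Ωmax Δmax K Ω Δ →
        ∀ ψ : ℝ → Rydberg.QState n, Rydberg.IsEvolution G ω₀ T Ω Δ ψ →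
          Rydberg.IsIndepState G (ψ 0) →
          √(1 - Rydberg.probIS G (ψ 1)) ≤
            Rydberg.a₁ Ωmax T * Rydberg.a₃ Ωmax Δmax K T * (n : ℝ) ^ 2 * Rydberg.tau ω₀ T
            + (Rydberg.a₁ Ωmax T ^ 2 * Rydberg.a₃ Ωmax Δmax K T
                + Real.pi / 8 * Ωmax ^ 3 * T ^ 3) * (n : ℝ) ^ 3 * Rydberg.tau ω₀ T ^ 2
            + C * ((n : ℝ) ^ 4 * Rydberg.tau ω₀ T ^ 3))
    ∧
    -- fixed runtime, blockade strength growing at least like `n ^ 2`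
    (∀ T Ωmax Δmax K c : ℝ, 0 < T → 0 ≤ Ωmax → 0 ≤ Δmax → 0 ≤ K → 0 < c →
      ∀ ε : ℝ, 0 < ε → ∃ n₀ : ℕ, ∀ n : ℕ, n₀ ≤ n →
        ∀ (G : SimpleGraph (Fin n)) (ω₀ : ℝ) (L : ℕ), 0 < L → ω₀ * T = 2 * Real.pi * L →
        c * (n : ℝ) ^ 2 ≤ ω₀ →
        ∀ Ω Δ : ℝ → ℝ, Rydberg.IsSchedule L Ωmax Δmax K Ω Δ →
        ∀ ψ : ℝ → Rydberg.QState n, Rydberg.IsEvolution G ω₀ T Ω Δ ψ →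
          Rydberg.IsIndepState G (ψ 0) →
          √(1 - Rydberg.probIS G (ψ 1)) ≤ ε)
    ∧
    -- fixed blockade strength, runtime `O(n ^ 2)`, controls rescaled accordingly
    (∀ ω₀ Ωmax Δmax K c : ℝ, 0 < ω₀ → 0 ≤ Ωmax → 0 ≤ Δmax → 0 ≤ K → 0 < c →
      ∀ ε : ℝ, 0 < ε → ∃ n₀ : ℕ, ∀ n : ℕ, n₀ ≤ n →
        ∀ (G : SimpleGraph (Fin n)) (T : ℝ) (L : ℕ), 0 < L → ω₀ * T = 2 * Real.pi * L →
        T ≤ c * (n : ℝ) ^ 2 →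
        ∀ Ω Δ : ℝ → ℝ,
          Rydberg.IsSchedule L (Ωmax / (n : ℝ) ^ 2) (Δmax / (n : ℝ) ^ 2) (K / (n : ℝ) ^ 2) Ω Δ →
        ∀ ψ : ℝ → Rydberg.QState n, Rydberg.IsEvolution G ω₀ T Ω Δ ψ →
          Rydberg.IsIndepState G (ψ 0) →
          √(1 - Rydberg.probIS G (ψ 1)) ≤ ε ∧ 1 - ε ≤ Rydberg.probIS G (ψ 1)) := by
  refine ⟨fun T Ωmax Δmax K hT hΩ hΔ hK hKΔ => ?_, fun T Ωmax Δmax K c hT hΩ hΔ hK hc ε hε => ?_,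
    fun ω₀ Ωmax Δmax K c hω₀ hΩ hΔ hK hc ε hε => ?_⟩
  · obtain ⟨n₀, h⟩ := Rydberg.leakage_bound T Ωmax Δmax K hT hΩ hΔ hK hKΔ
    -- For large n the first term alone dominates the leakage, so C = 0 serves and the second term
    -- need only be nonnegative.
    refine ⟨0, le_rfl, n₀, fun n hn G ω₀ L hL hω Ω Δ hs ψ hψ h0 => ?_⟩
    have hω' : 0 < ω₀ * T := by rw [hω]; positivity
    have hrest : 0 ≤ (Rydberg.a₁ Ωmax T ^ 2 * Rydberg.a₃ Ωmax Δmax K T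
        + Real.pi / 8 * Ωmax ^ 3 * T ^ 3) * (n : ℝ) ^ 3 * Rydberg.tau ω₀ T ^ 2 := by
      unfold Rydberg.a₃
      positivity
    linarith [h n hn G ω₀ L hω' Ω Δ hs ψ hψ h0]
  · obtain ⟨n₀, h⟩ :=
      Rydberg.leakage_tendsto_zero_of_fixed_runtime T Ωmax Δmax K c hT hΩ hΔ hK hc ε hε
    exact ⟨n₀, fun n hn G ω₀ L _ _ hω₀ => h n hn G ω₀ L hω₀⟩
  · obtain ⟨n₀, h⟩ := Rydberg.leakage_tendsto_zero_of_fixed_blockade ω₀ Ωmax Δmax K c hω₀ hΩ hΔ hK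
      -- Capping at 1 makes the square at most ε, which turns the bound on the square root into one
      -- on the probability.
      (min ε 1) (lt_min hε one_pos)
    refine ⟨n₀, fun n hn G T L hL hω hTn Ω Δ hs ψ hψ h0 => ?_⟩
    have hT : 0 < T := pos_of_mul_pos_right (hω ▸ by positivity) hω₀.le
    have hle := h n hn G T L hT hTn Ω Δ hs ψ hψ h0
    refine ⟨hle.trans (min_le_left _ _), ?_⟩
    rw [Real.sqrt_le_left (by positivity)] at hle
    have hsq : min ε 1 ^ 2 ≤ ε := by
      rw [pow_two]
      exact (mul_le_of_le_one_right (by positivity) (min_le_right _ _)).trans (min_le_left _ _)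
    linarith
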